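/- Let $N\ge 0$, $n_1,\dots,n_N\ge 0$ be integers and let $\mathcal U$ be a complex Hilbert space; $L(\cdot)$ denotes bounded linear operators. Put $$\Pi=\{Z=(Z_1,\dots,Z_N): Z_k\in\mathbb C^{n_k\times n_k},\ Z_k+Z_k^*>0\},\qquad \Omega=\bigcup_{|\lambda|=1}\lambda\Pi,$$ $$\mathbb D=\{W=(W_1,\dots,W_N): W_k\in\mathbb C^{n_k\times n_k},\ W_kW_k^*<I_{n_k}\}.$$ Let $\mathcal B_{n_1,\dots,n_N}(\mathcal U)$ be the class of holomorphic functions $f:\Omega\to L(\mathcal U)$ for which there are Hilbert spaces $\mathcal M_1,\dots,\mathcal M_N,\mathcal H$ and operators $G_k\in L(\mathcal U\oplus\mathcal H,\mathbb C^{n_k}\otimes\mathcal M_k)$ such that, with $$\sum_{k=1}^N G_k^*(Z_k\otimes I_{\mathcal M_k})G_k=\begin{bmatrix}a(Z)&b(Z)\\ c(Z)&d(Z)\end{bmatrix}\in L(\mathcal U\oplus\mathcal H),$$ the operator $d(Z)$ is boundedly invertible and $f(Z)=a(Z)-b(Z)d(Z)^{-1}c(Z)$ for all $Z\in\Omega$.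 For $f$ in this class, the double Cayley transform of $f$ is the function on $\mathbb D$ $$\mathcal C(f)(W)=(f(Z)-I_{\mathcal U})(f(Z)+I_{\mathcal U})^{-1},\qquad Z_k=(I_{n_k}+W_k)(I_{n_k}-W_k)^{-1}.$$ Then $\mathcal C(f)$ is well defined for every $f\in\mathcal B_{n_1,\dots,n_N}(\mathcal U)$, that is, $f(Z)+I_{\mathcal U}$ is boundedly invertible for all $W\in\mathbb D$. Moreover, a holomorphic function $F:\mathbb D\to L(\mathcal U)$ satisfies $F=\mathcal C(f)$ on $\mathbb D$ for some $f\in\mathcal B_{n_1,\dots,n_N}(\mathcal U)$ if and only if the following two conditions hold. (i) There exist a Hilbert space $\mathcal X$ and an operator $$U=\begin{bmatrix}A&B\\ C&D\end{bmatrix}\in L\bigl((\mathbb C^{n_1+\cdots+n_N}\otimes\mathcal X)\oplus\mathcal U\bigr),\qquad U=U^*=U^{-1},$$ such that for all $W\in\mathbb D$, with $P(W)=\mathrm{diag}(W_1,\dots,W_N)$, the operator $I-A(P(W)\otimes I_{\mathcal X})$ is boundedly invertible and $$F(W)=D+C(P(W)\otimes I_{\mathcal X})\bigl(I-A(P(W)\otimes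 I_{\mathcal X})\bigr)^{-1}B.$$ (ii) $1\notin\sigma(F(0))$. -/

import Mathlib

open scoped TensorProduct ComplexOrder

universe u v

noncomputable section

namespace Bessmertnyi

/-- The algebraic tensor product `ℂ^ι ⊗ M` (with its Hilbert inner product) of a finite-dimensional
space and a Hilbert space `M` is already complete, hence is the Hilbert space tensor product. -/
instance completeSpace_tensor (ι : Type v) [Fintype ι] (M : Type u) [NormedAddCommGroup M]
    [InnerProductSpace ℂ M] [CompleteSpace M] :
    CompleteSpace (EuclideanSpace ℂ ι ⊗[ℂ] M) := by
  classical
  let c : (EuclideanSpace ℂ ι ⊗[ℂ] M) →L[ℂ] (ι → M) :=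
    ContinuousLinearMap.pi fun i =>
      (TensorProduct.lidIsometry ℂ M).toContinuousLinearEquiv.toContinuousLinearMap ∘L
        (EuclideanSpace.proj i : EuclideanSpace ℂ ι →L[ℂ] ℂ).rTensor M
  let d : (ι → M) →L[ℂ] (EuclideanSpace ℂ ι ⊗[ℂ] M) :=
    ∑ i, (TensorProduct.mkL ℂ (EuclideanSpace ℂ ι) M (EuclideanSpace.single i 1)) ∘L
      ContinuousLinearMap.proj i
  have h1 : ∀ x, d (c x) = x := by
    intro x
    induction x with
    | zero => simp
    | add x y hx hy => rw [map_add, map_add, hx, hy]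
    | tmul e m =>
      have he : e = ∑ i, e i • EuclideanSpace.single i (1 : ℂ) := by
        ext j
        simp [Finset.sum_apply, Pi.single_apply]
      conv_rhs => rw [he, TensorProduct.sum_tmul]
      simp [d, c, TensorProduct.smul_tmul]
  have h2 : ∀ y, c (d y) = y := by
    intro y
    ext i
    simp [d, c]
  let e : (EuclideanSpace ℂ ι ⊗[ℂ] M) ≃L[ℂ] (ι → M) := ContinuousLinearEquiv.equivOfInverse c d h1 h2
  exact (completeSpace_congr (e := e.toEquiv) e.isUniformEmbedding).2 inferInstance

section Blocks

variable {E F : Type*} [NormedAddCommGroup E] [InnerProductSpace ℂ E]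
  [NormedAddCommGroup F] [InnerProductSpace ℂ F]

/-- The embedding of `E` in the orthogonal direct sum `E ⊕ F = WithLp 2 (E × F)`. -/
def inlL (E F : Type*) [NormedAddCommGroup E] [InnerProductSpace ℂ E]
    [NormedAddCommGroup F] [InnerProductSpace ℂ F] : E →L[ℂ] WithLp 2 (E × F) :=
  (WithLp.prodContinuousLinearEquiv 2 ℂ E F).symm.toContinuousLinearMap ∘L
    ContinuousLinearMap.inl ℂ E F

/-- The embedding of `F` in the orthogonal direct sum `E ⊕ F`. -/
def inrL (E F : Type*) [NormedAddCommGroup E] [InnerProductSpace ℂ E]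
    [NormedAddCommGroup F] [InnerProductSpace ℂ F] : F →L[ℂ] WithLp 2 (E × F) :=
  (WithLp.prodContinuousLinearEquiv 2 ℂ E F).symm.toContinuousLinearMap ∘L
    ContinuousLinearMap.inr ℂ E F

/-- The upper left block of an operator on `E ⊕ F`. -/
def block11 (T : WithLp 2 (E × F) →L[ℂ] WithLp 2 (E × F)) : E →L[ℂ] E :=
  WithLp.fstL 2 ℂ E F ∘L T ∘L inlL E F

/-- The upper right block of an operator on `E ⊕ F`. -/
def block12 (T : WithLp 2 (E × F) →L[ℂ] WithLp 2 (E × F)) : F →L[ℂ] E :=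
  WithLp.fstL 2 ℂ E F ∘L T ∘L inrL E F

/-- The lower left block of an operator on `E ⊕ F`. -/
def block21 (T : WithLp 2 (E × F) →L[ℂ] WithLp 2 (E × F)) : E →L[ℂ] F :=
  WithLp.sndL 2 ℂ E F ∘L T ∘L inlL E F

/-- The lower right block of an operator on `E ⊕ F`. -/
def block22 (T : WithLp 2 (E × F) →L[ℂ] WithLp 2 (E × F)) : F →L[ℂ] F :=
  WithLp.sndL 2 ℂ E F ∘L T ∘L inrL E F

end Blocks

/-- The operator `Z ⊗ I_M` on `ℂ^ι ⊗ M`. -/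
def tensorId {ι : Type v} [Fintype ι] [DecidableEq ι] (Z : Matrix ι ι ℂ) (M : Type u)
    [NormedAddCommGroup M] [InnerProductSpace ℂ M] :
    (EuclideanSpace ℂ ι ⊗[ℂ] M) →L[ℂ] (EuclideanSpace ℂ ι ⊗[ℂ] M) :=
  (Matrix.toEuclideanCLM (n := ι) (𝕜 := ℂ) Z).rTensor M

/-- Tuples `(Z_1, …, Z_N)` of complex matrices, `Z_k` of size `n_k × n_k`. -/
abbrev MatTuple {N : ℕ} (n : Fin N → ℕ) : Type :=
  ∀ k, Matrix (Fin (n k)) (Fin (n k)) ℂ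

/-- The product of the open right matrix halfplanes `Z_k + Z_k^* > 0`. -/
def halfplane {N : ℕ} (n : Fin N → ℕ) : Set (MatTuple n) :=
  {Z | ∀ k, (Z k + (Z k).conjTranspose).PosDef}

/-- The domain `⋃_{|λ| = 1} λ Π`, where `Π` is the product of the matrix halfplanes. -/
def omega {N : ℕ} (n : Fin N → ℕ) : Set (MatTuple n) :=
  {Z | ∃ l : ℂ, ‖l‖ = 1 ∧ ∃ Y ∈ halfplane n, Z = l • Y}

/-- The product of the open matrix unit disks `W_k W_k^* < I`. -/
def disk {N : ℕ} (n : Fin N → ℕ) : Set (MatTuple n) :=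
  {W | ∀ k, (1 - W k * (W k).conjTranspose).PosDef}

/-- The linear pencil `A(Z) = ∑_k G_k^* (Z_k ⊗ I_{M_k}) G_k` on `𝒰 ⊕ H`. -/
def pencil {N : ℕ} {n : Fin N → ℕ} {𝒰 H : Type u} {M : Fin N → Type u}
    [NormedAddCommGroup 𝒰] [InnerProductSpace ℂ 𝒰] [CompleteSpace 𝒰]
    [NormedAddCommGroup H] [InnerProductSpace ℂ H] [CompleteSpace H]
    [∀ k, NormedAddCommGroup (M k)] [∀ k, InnerProductSpace ℂ (M k)] [∀ k, CompleteSpace (M k)]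
    (G : ∀ k, WithLp 2 (𝒰 × H) →L[ℂ] (EuclideanSpace ℂ (Fin (n k)) ⊗[ℂ] M k)) (Z : MatTuple n) :
    WithLp 2 (𝒰 × H) →L[ℂ] WithLp 2 (𝒰 × H) :=
  ∑ k, ContinuousLinearMap.adjoint (G k) ∘L tensorId (Z k) (M k) ∘L G k

/-- The Bessmertnyĭ class: functions holomorphic on `omega n` (values elsewhere are irrelevant) of
the form `f(Z) = a(Z) - b(Z) d(Z)⁻¹ c(Z)`, where `a, b, c, d` are the blocks of a pencil
and `d(Z)` is boundedly invertible for all `Z` in `omega n`. -/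
def bessmertnyiClass {N : ℕ} (n : Fin N → ℕ) (𝒰 : Type u)
    [NormedAddCommGroup 𝒰] [InnerProductSpace ℂ 𝒰] [CompleteSpace 𝒰] :
    Set (MatTuple n → 𝒰 →L[ℂ] 𝒰) :=
  {f | DifferentiableOn ℂ f (omega n) ∧
    ∃ (M : Fin N → Type u) (_ : ∀ k, NormedAddCommGroup (M k))
      (_ : ∀ k, InnerProductSpace ℂ (M k)) (_ : ∀ k, CompleteSpace (M k))
      (H : Type u) (_ : NormedAddCommGroup H) (_ : InnerProductSpace ℂ H) (_ : CompleteSpace H)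
      (G : ∀ k, WithLp 2 (𝒰 × H) →L[ℂ] (EuclideanSpace ℂ (Fin (n k)) ⊗[ℂ] M k)),
      ∀ Z ∈ omega n, IsUnit (block22 (pencil G Z)) ∧
        f Z = block11 (pencil G Z) -
          block12 (pencil G Z) ∘L Ring.inverse (block22 (pencil G Z)) ∘L block21 (pencil G Z)}

/-- The Cayley transform over the variables, `Z_k = (I + W_k)(I - W_k)⁻¹`. -/
def cayley {N : ℕ} {n : Fin N → ℕ} (W : MatTuple n) : MatTuple n :=
  fun k => (1 + W k) * (1 - W k)⁻¹

/-- The double Cayley transform `W ↦ (f(Z) - I)(f(Z) + I)⁻¹`, `Z = cayley W`. -/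
def doubleCayley {N : ℕ} {n : Fin N → ℕ} {𝒰 : Type u}
    [NormedAddCommGroup 𝒰] [InnerProductSpace ℂ 𝒰] (f : MatTuple n → 𝒰 →L[ℂ] 𝒰)
    (W : MatTuple n) : 𝒰 →L[ℂ] 𝒰 :=
  (f (cayley W) - 1) * Ring.inverse (f (cayley W) + 1)

/-- The index set of `ℂ^{n_1 + ⋯ + n_N} = ⨁_k ℂ^{n_k}`. -/
abbrev Idx {N : ℕ} (n : Fin N → ℕ) : Type := Σ k : Fin N, Fin (n k)

/-- `F(W) = D + C (P(W) ⊗ I)(I - A (P(W) ⊗ I))⁻¹ B` on the product of matrix disks, where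
`P(W) = diag(W_1, …, W_N)` and `A, B, C, D` are the blocks of `T`. -/
def IsRealizedBy {N : ℕ} {n : Fin N → ℕ} {𝒰 X : Type u}
    [NormedAddCommGroup 𝒰] [InnerProductSpace ℂ 𝒰] [NormedAddCommGroup X] [InnerProductSpace ℂ X]
    (F : MatTuple n → 𝒰 →L[ℂ] 𝒰)
    (T : WithLp 2 ((EuclideanSpace ℂ (Idx n) ⊗[ℂ] X) × 𝒰) →L[ℂ]
      WithLp 2 ((EuclideanSpace ℂ (Idx n) ⊗[ℂ] X) × 𝒰)) : Prop :=
  ∀ W ∈ disk n,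
    IsUnit (1 - block11 T ∘L tensorId (Matrix.blockDiagonal' W) X) ∧
    F W = block22 T + block21 T ∘L tensorId (Matrix.blockDiagonal' W) X ∘L
      Ring.inverse (1 - block11 T ∘L tensorId (Matrix.blockDiagonal' W) X) ∘L block12 T

end Bessmertnyi

end

/-!
Merge the coefficients `G_k` into one operator `G : 𝒰 ⊕ H → ℂ^{n_1 + ⋯ + n_N} ⊗ X`, so that the
pencil is `G^* Z G` with `Z = diag(Z_1, …, Z_N) ⊗ I_X`. Where the real part of `Z` is positive, the
pencil and its Schur complement `f` have nonnegative real part; hence `f + I` is invertible.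

The colligation of `𝒞(f)` is the reflection `T` whose `-1`-eigenspace is the closure of
`{(-G(u, h), u)}`. Given `u`, choose `h` with `G^* Z G (u, h) = (f u, 0)` and put `x = G(u, h)`.
Then `(Z x, f u)` is orthogonal to all `(-G(u', h'), u')`, so `T` fixes it and negates `(-x, u)`.
Adding the two relations, with `W = (Z - I)(Z + I)⁻¹`, gives
`T (W (Z x + x), (f + I) u) = (Z x + x, (f - I) u)`: the transfer function of `T` at `W` is
`(f - I)(f + I)⁻¹`.

Conversely, if `I - D` is invertible then every vector of the `-1`-eigenspace of `T` is
`(-B (I - D)⁻¹ u - h, u)` for some `u : 𝒰` and some `h` in `H = {x | T (x, 0) = -(x, 0)}`. So `T`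
is the colligation of `G(u, h) = B (I - D)⁻¹ u + h`. This `G` is isometric on `H`, which makes the
lower right block of its pencil invertible on all of `Ω`.
-/

noncomputable section

namespace Bessmertnyi

open ContinuousLinearMap

section CStarAlgebra

variable {A : Type*} [CStarAlgebra A] [PartialOrder A] [StarOrderedRing A]

theorem exists_pos_algebraMap_le_of_isStrictlyPositive {a : A} (ha : IsStrictlyPositive a) :
    ∃ δ > 0, algebraMap ℝ A δ ≤ a := by
  rcases subsingleton_or_nontrivial A with _ | _
  · exact ⟨1, one_pos, (Subsingleton.elim _ _).le⟩
  · exact (CFC.exists_pos_algebraMap_le_iff ha.isSelfAdjoint).2 fun x hx => ha.spectrum_pos hx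

theorem norm_lt_one_of_isStrictlyPositive_one_sub_mul_star {a : A}
    (ha : IsStrictlyPositive (1 - a * star a)) : ‖a‖ < 1 := by
  nontriviality A
  obtain ⟨δ, hδ, hle⟩ := exists_pos_algebraMap_le_of_isStrictlyPositive ha
  have hle' : a * star a ≤ algebraMap ℝ A (1 - δ) := by
    rw [map_sub, map_one]
    exact le_sub_comm.1 hle
  have hδ1 : 0 ≤ 1 - δ :=
    algebraMap_le_algebraMap.1 ((map_zero _).trans_le ((mul_star_self_nonneg a).trans hle'))
  have hnorm : ‖a‖ * ‖a‖ ≤ 1 - δ := by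
    rw [← CStarRing.norm_self_mul_star]
    exact (CStarAlgebra.norm_le_iff_le_algebraMap _ hδ1 (mul_star_self_nonneg a)).2 hle'
  nlinarith [norm_nonneg a]

theorem isUnit_one_sub_of_isStrictlyPositive_one_sub_mul_star {a : A}
    (ha : IsStrictlyPositive (1 - a * star a)) : IsUnit (1 - a) :=
  isUnit_one_sub_of_norm_lt_one (norm_lt_one_of_isStrictlyPositive_one_sub_mul_star ha)

theorem isStrictlyPositive_add_star_of_one_sub_mul_eq {w z : A}
    (hw : IsStrictlyPositive (1 - w * star w)) (hwz : (1 - w) * z = 1 + w) :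
    IsStrictlyPositive (z + star z) := by
  have hu : IsUnit (1 - w) := isUnit_one_sub_of_isStrictlyPositive_one_sub_mul_star hw
  have hstar : star z * star (1 - w) = 1 + star w := by rw [← star_mul, hwz, star_add, star_one]
  have key : (1 - w) * (z + star z) * star (1 - w) = (1 - w * star w) + (1 - w * star w) := by
    rw [mul_add, add_mul, hwz, mul_assoc _ (star z), hstar, star_sub, star_one]
    noncomm_ring
  rw [← hu.isStrictlyPositive_star_right_conjugate_iff, key]
  exact hw.add_nonneg hw.nonneg

end CStarAlgebra

theorem isStrictlyPositive_map {A B F : Type*} [Semiring A] [StarRing A] [PartialOrder A]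
    [StarOrderedRing A] [Semiring B] [StarRing B] [PartialOrder B] [StarOrderedRing B]
    [FunLike F A B] [RingHomClass F A B] [NonUnitalStarRingHomClass F A B] (φ : F) {a : A}
    (ha : IsStrictlyPositive a) : IsStrictlyPositive (φ a) :=
  (ha.isUnit.map φ).isStrictlyPositive (map_nonneg φ ha.nonneg)

theorem isStrictlyPositive_pi_iff {ι : Type*} {A : ι → Type*} [∀ i, Monoid (A i)]
    [∀ i, Zero (A i)] [∀ i, LE (A i)] {a : ∀ i, A i} :
    IsStrictlyPositive a ↔ ∀ i, IsStrictlyPositive (a i) := by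
  simp only [IsStrictlyPositive, Pi.isUnit_iff, forall_and, Pi.le_def, Pi.zero_apply]

section Tuples

open scoped MatrixOrder Matrix.Norms.L2Operator

variable {N : ℕ} {n : Fin N → ℕ}

theorem mem_disk_iff {W : MatTuple n} : W ∈ disk n ↔ IsStrictlyPositive (1 - W * star W) := by
  rw [isStrictlyPositive_pi_iff]
  exact forall_congr' fun k => Matrix.isStrictlyPositive_iff_posDef.symm

theorem mem_halfplane_iff {Z : MatTuple n} :
    Z ∈ halfplane n ↔ IsStrictlyPositive (Z + star Z) := by
  rw [isStrictlyPositive_pi_iff]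
  exact forall_congr' fun k => Matrix.isStrictlyPositive_iff_posDef.symm

theorem zero_mem_disk : (0 : MatTuple n) ∈ disk n := fun k => by
  simpa using Matrix.PosDef.one

theorem one_sub_mul_cayley {W : MatTuple n} (hW : W ∈ disk n) :
    (1 - W) * cayley W = 1 + W := by
  have hu := isUnit_one_sub_of_isStrictlyPositive_one_sub_mul_star (mem_disk_iff.1 hW)
  funext k
  have hk : IsUnit (1 - W k).det := (Matrix.isUnit_iff_isUnit_det _).1 (Pi.isUnit_iff.1 hu k)
  calc (1 - W k) * ((1 + W k) * (1 - W k)⁻¹) = (1 + W k) * ((1 - W k) * (1 - W k)⁻¹) := by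
        noncomm_ring
    _ = 1 + W k := by rw [Matrix.mul_nonsing_inv _ hk, mul_one]

theorem cayley_mem_halfplane {W : MatTuple n} (hW : W ∈ disk n) : cayley W ∈ halfplane n :=
  mem_halfplane_iff.2 <|
    isStrictlyPositive_add_star_of_one_sub_mul_eq (mem_disk_iff.1 hW) (one_sub_mul_cayley hW)

theorem halfplane_subset_omega : halfplane n ⊆ omega n := fun Z hZ =>
  ⟨1, norm_one, Z, hZ, (one_smul ℂ Z).symm⟩

end Tuples

section TensorId

/-- The unital `*`-homomorphism `T ↦ T ⊗ I_X`. -/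
def rTensorStarAlgHom (E X : Type*) [NormedAddCommGroup E] [InnerProductSpace ℂ E]
    [CompleteSpace E] [NormedAddCommGroup X] [InnerProductSpace ℂ X] [CompleteSpace X]
    [CompleteSpace (E ⊗[ℂ] X)] : (E →L[ℂ] E) →⋆ₐ[ℂ] (E ⊗[ℂ] X →L[ℂ] E ⊗[ℂ] X) where
  toFun := rTensor X
  map_one' := rTensor_one X
  map_mul' S T := rTensor_mul X S T
  map_zero' := rTensor_zero X
  map_add' S T := rTensor_add X S T
  commutes' c := by rw [Algebra.algebraMap_eq_smul_one, rTensor_smul, rTensor_one,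
    Algebra.algebraMap_eq_smul_one]
  map_star' T := (adjoint_rTensor X T).symm

/-- The unital `*`-homomorphism assembling square matrices into a block diagonal matrix. -/
def blockDiagonalStarAlgHom {o : Type*} [Fintype o] [DecidableEq o] (m : o → Type*)
    [∀ k, Fintype (m k)] [∀ k, DecidableEq (m k)] :
    (∀ k, Matrix (m k) (m k) ℂ) →⋆ₐ[ℂ] Matrix (Σ k, m k) (Σ k, m k) ℂ where
  __ := AlgHom.mk' (Matrix.blockDiagonal'RingHom m ℂ) Matrix.blockDiagonal'_smul
  map_star' Z := (Matrix.blockDiagonal'_conjTranspose Z).symm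

/-- The unital `*`-homomorphism `Z ↦ diag(Z_1, …, Z_N) ⊗ I_X`. -/
def blockTensor {N : ℕ} (n : Fin N → ℕ) (X : Type u) [NormedAddCommGroup X]
    [InnerProductSpace ℂ X] [CompleteSpace X] :
    MatTuple n →⋆ₐ[ℂ]
      (EuclideanSpace ℂ (Idx n) ⊗[ℂ] X →L[ℂ] EuclideanSpace ℂ (Idx n) ⊗[ℂ] X) :=
  (rTensorStarAlgHom (EuclideanSpace ℂ (Idx n)) X).comp <|
    (Matrix.toEuclideanCLM (n := Idx n) (𝕜 := ℂ) : _ →⋆ₐ[ℂ] _).comp <|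
      blockDiagonalStarAlgHom fun k => Fin (n k)

variable {N : ℕ} {n : Fin N → ℕ} {X : Type u} [NormedAddCommGroup X]
  [InnerProductSpace ℂ X] [CompleteSpace X]

theorem tensorId_blockDiagonal' (Z : MatTuple n) :
    tensorId (Matrix.blockDiagonal' Z) X = blockTensor n X Z := rfl

open scoped MatrixOrder Matrix.Norms.L2Operator

theorem isStrictlyPositive_blockTensor_add_star {Z : MatTuple n} (hZ : Z ∈ halfplane n) :
    IsStrictlyPositive (blockTensor n X Z + star (blockTensor n X Z)) := by
  rw [← map_star, ← map_add]
  exact isStrictlyPositive_map (blockTensor n X) (mem_halfplane_iff.1 hZ)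

theorem norm_blockTensor_lt_one {W : MatTuple n} (hW : W ∈ disk n) : ‖blockTensor n X W‖ < 1 := by
  refine norm_lt_one_of_isStrictlyPositive_one_sub_mul_star (a := blockTensor n X W) ?_
  rw [← map_star, ← map_mul, ← map_one (blockTensor n X), ← map_sub]
  exact isStrictlyPositive_map (blockTensor n X) (mem_disk_iff.1 hW)

theorem one_sub_mul_blockTensor_cayley {W : MatTuple n} (hW : W ∈ disk n) :
    (1 - blockTensor n X W) * blockTensor n X (cayley W) = 1 + blockTensor n X W := by
  rw [← map_one (blockTensor n X), ← map_sub, ← map_mul, ← map_add, one_sub_mul_cayley hW]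

end TensorId

section Operators

variable {E F : Type*} [NormedAddCommGroup E] [InnerProductSpace ℂ E]
  [NormedAddCommGroup F] [InnerProductSpace ℂ F]

theorem inverse_apply_apply {T : E →L[ℂ] E} (hT : IsUnit T) (x : E) :
    Ring.inverse T (T x) = x :=
  congr($(Ring.inverse_mul_cancel T hT) x)

theorem apply_inverse_apply {T : E →L[ℂ] E} (hT : IsUnit T) (x : E) :
    T (Ring.inverse T x) = x :=
  congr($(Ring.mul_inverse_cancel T hT) x)

theorem isUnit_of_le_re_inner [CompleteSpace E] (T : E →L[ℂ] E) {δ : ℝ} (hδ : 0 < δ)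
    (h : ∀ x, δ * ‖x‖ ^ 2 ≤ (inner ℂ (T x) x).re) : IsUnit T := by
  refine isUnit_of_forall_le_norm_inner_map T (c := ⟨δ, hδ.le⟩) hδ fun x => ?_
  rw [mul_comm]
  exact (h x).trans (Complex.re_le_norm _)

theorem exists_pos_le_re_inner_of_isStrictlyPositive_add_star [CompleteSpace E] {T : E →L[ℂ] E}
    (hT : IsStrictlyPositive (T + star T)) :
    ∃ δ > 0, ∀ x, δ * ‖x‖ ^ 2 ≤ (inner ℂ (T x) x).re := by
  obtain ⟨δ, hδ, hle⟩ := exists_pos_algebraMap_le_of_isStrictlyPositive hT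
  refine ⟨δ / 2, half_pos hδ, fun x => ?_⟩
  have hx := (le_def _ _).1 hle |>.re_inner_nonneg_left x
  have hself : (inner ℂ x x).re = ‖x‖ ^ 2 := inner_self_eq_norm_sq (𝕜 := ℂ) x
  have hstar : (inner ℂ (star T x) x).re = (inner ℂ (T x) x).re := by
    rw [star_eq_adjoint, adjoint_inner_left]
    exact inner_re_symm (𝕜 := ℂ) x (T x)
  have hsmul : algebraMap ℝ (E →L[ℂ] E) δ x = (δ : ℂ) • x :=
    RCLike.real_smul_eq_coe_smul (K := ℂ) δ x
  rw [_root_.sub_apply, _root_.add_apply, inner_sub_left, inner_add_left, hsmul, inner_smul_left,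
    Complex.conj_ofReal, RCLike.re_to_complex, Complex.sub_re, Complex.add_re,
    Complex.re_ofReal_mul, hstar, hself] at hx
  linarith

theorem inlL_apply (x : E) : inlL E F x = WithLp.toLp 2 (x, 0) := rfl

theorem inrL_apply (y : F) : inrL E F y = WithLp.toLp 2 (0, y) := rfl

theorem apply_toLp_eq (T : WithLp 2 (E × F) →L[ℂ] WithLp 2 (E × F)) (x : E) (y : F) :
    T (WithLp.toLp 2 (x, y)) =
      WithLp.toLp 2 (block11 T x + block12 T y, block21 T x + block22 T y) := by
  have h : WithLp.toLp 2 (x, y) = inlL E F x + inrL E F y := by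
    rw [inlL_apply, inrL_apply, ← WithLp.toLp_add, Prod.mk_add_mk, add_zero, zero_add]
  rw [h, map_add]
  rfl

theorem norm_block11_le (T : WithLp 2 (E × F) →L[ℂ] WithLp 2 (E × F)) : ‖block11 T‖ ≤ ‖T‖ :=
  opNorm_le_bound _ (norm_nonneg T) fun x =>
    calc ‖(T (inlL E F x)).fst‖ ≤ ‖T (inlL E F x)‖ := WithLp.norm_fst_le _ _
      _ ≤ ‖T‖ * ‖inlL E F x‖ := T.le_opNorm _
      _ = ‖T‖ * ‖x‖ := by rw [inlL_apply, WithLp.norm_toLp_fst]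

theorem inner_block22_apply (T : WithLp 2 (E × F) →L[ℂ] WithLp 2 (E × F)) (x y : F) :
    inner ℂ (block22 T x) y = inner ℂ (T (inrL E F x)) (inrL E F y) := by
  rw [WithLp.prod_inner_apply, inrL_apply y, inner_zero_right, zero_add]
  rfl

end Operators

section Schur

variable {E F : Type*} [NormedAddCommGroup E] [InnerProductSpace ℂ E]
  [NormedAddCommGroup F] [InnerProductSpace ℂ F]

/-- The Schur complement `a - b d⁻¹ c` of the lower right block of an operator on `E ⊕ F`; it is
meaningful only when `d` is invertible. -/
def schur (S : WithLp 2 (E × F) →L[ℂ] WithLp 2 (E × F)) : E →L[ℂ] E :=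
  block11 S - block12 S ∘L Ring.inverse (block22 S) ∘L block21 S

theorem exists_apply_eq_schur {S : WithLp 2 (E × F) →L[ℂ] WithLp 2 (E × F)}
    (hS : IsUnit (block22 S)) (u : E) :
    ∃ h : F, S (WithLp.toLp 2 (u, h)) = WithLp.toLp 2 (schur S u, 0) := by
  refine ⟨-Ring.inverse (block22 S) (block21 S u), ?_⟩
  rw [apply_toLp_eq, map_neg, map_neg, apply_inverse_apply hS, add_neg_cancel, ← sub_eq_add_neg]
  rfl

theorem isUnit_schur_add_one [CompleteSpace E] {S : WithLp 2 (E × F) →L[ℂ] WithLp 2 (E × F)}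
    (hS : IsUnit (block22 S)) (hre : ∀ x, 0 ≤ (inner ℂ (S x) x).re) : IsUnit (schur S + 1) := by
  refine isUnit_of_le_re_inner _ one_pos fun u => ?_
  obtain ⟨h, hh⟩ := exists_apply_eq_schur hS u
  have hschur : 0 ≤ (inner ℂ (schur S u) u).re := by
    simpa [hh, WithLp.prod_inner_apply] using hre (WithLp.toLp 2 (u, h))
  have hself : (inner ℂ u u).re = ‖u‖ ^ 2 := inner_self_eq_norm_sq (𝕜 := ℂ) u
  rw [_root_.add_apply, one_apply_eq_self, inner_add_left, Complex.add_re, hself, one_mul]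
  exact le_add_of_nonneg_left hschur

theorem differentiableAt_schur_comp {V : Type*} [NormedAddCommGroup V] [NormedSpace ℂ V]
    [CompleteSpace F] {S : V → WithLp 2 (E × F) →L[ℂ] WithLp 2 (E × F)} {z : V}
    (hS : DifferentiableAt ℂ S z) (hz : IsUnit (block22 (S z))) :
    DifferentiableAt ℂ (fun z => schur (S z)) z := by
  have h22 : DifferentiableAt ℂ (fun z => block22 (S z)) z := by unfold block22; fun_prop
  have hinv : DifferentiableAt ℂ (fun z => Ring.inverse (block22 (S z))) z :=
    DifferentiableAt.comp (g := Ring.inverse) z (differentiableAt_inverse hz) h22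
  have h12 : DifferentiableAt ℂ (fun z => block12 (S z)) z := by unfold block12; fun_prop
  have h21 : DifferentiableAt ℂ (fun z => block21 (S z)) z := by unfold block21; fun_prop
  have h11 : DifferentiableAt ℂ (fun z => block11 (S z)) z := by unfold block11; fun_prop
  exact h11.sub (h12.clm_comp (hinv.clm_comp h21))

end Schur

section Transfer

variable {K 𝒰 : Type*} [NormedAddCommGroup K] [InnerProductSpace ℂ K]
  [NormedAddCommGroup 𝒰] [InnerProductSpace ℂ 𝒰]

/-- The transfer function `D + C W (I - A W)⁻¹ B` of a colligation with blocks `A, B, C, D`; it is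
meaningful only when `I - A W` is invertible. -/
def transfer (T : WithLp 2 (K × 𝒰) →L[ℂ] WithLp 2 (K × 𝒰)) (W : K →L[ℂ] K) : 𝒰 →L[ℂ] 𝒰 :=
  block22 T + block21 T ∘L W ∘L Ring.inverse (1 - block11 T ∘L W) ∘L block12 T

theorem transfer_zero (T : WithLp 2 (K × 𝒰) →L[ℂ] WithLp 2 (K × 𝒰)) :
    transfer T 0 = block22 T := by
  rw [transfer, zero_comp, comp_zero, add_zero]

theorem transfer_apply_eq {T : WithLp 2 (K × 𝒰) →L[ℂ] WithLp 2 (K × 𝒰)} {W : K →L[ℂ] K}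
    (hA : IsUnit (1 - block11 T ∘L W)) {s : K} {e φ : 𝒰}
    (h : T (WithLp.toLp 2 (W s, e)) = WithLp.toLp 2 (s, φ)) : transfer T W e = φ := by
  rw [apply_toLp_eq] at h
  have hs : block11 T (W s) + block12 T e = s := congrArg WithLp.fst h
  have hφ : block21 T (W s) + block22 T e = φ := congrArg WithLp.snd h
  have hB : block12 T e = (1 - block11 T ∘L W) s := eq_sub_of_add_eq' hs
  change block22 T e + block21 T (W (Ring.inverse (1 - block11 T ∘L W) (block12 T e))) = φ
  rw [hB, inverse_apply_apply hA, add_comm, hφ]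

end Transfer

section Reflection

variable {E : Type*} [NormedAddCommGroup E] [InnerProductSpace ℂ E] [CompleteSpace E]

/-- The orthogonal reflection of `E` with `-1`-eigenspace the closure of `S`. -/
def reflectionAlong (S : Submodule ℂ E) : E →L[ℂ] E :=
  Sᗮ.reflection.toContinuousLinearEquiv

variable (S : Submodule ℂ E)

theorem adjoint_reflectionAlong : adjoint (reflectionAlong S) = reflectionAlong S :=
  Sᗮ.reflection.adjoint_eq_symm

theorem reflectionAlong_mul_self : reflectionAlong S * reflectionAlong S = 1 :=
  ContinuousLinearMap.ext Sᗮ.reflection_reflection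

theorem norm_reflectionAlong_le_one : ‖reflectionAlong S‖ ≤ 1 :=
  Sᗮ.reflection.toLinearIsometry.norm_toContinuousLinearMap_le

variable {S}

theorem reflectionAlong_apply_of_mem {z : E} (hz : z ∈ S) : reflectionAlong S z = -z :=
  Submodule.reflection_mem_subspace_orthogonalComplement_eq_neg (S.le_orthogonal_orthogonal hz)

theorem reflectionAlong_apply_of_mem_orthogonal {z : E} (hz : z ∈ Sᗮ) :
    reflectionAlong S z = z :=
  Submodule.reflection_mem_subspace_eq_self hz

theorem reflectionAlong_ker_add_one {T : E →L[ℂ] E} (hT : adjoint T = T) (hTT : T * T = 1) :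
    reflectionAlong (T + 1).ker = T := by
  ext1 z
  have hTz : T (T z) = z := congr($hTT z)
  have hpos : z + T z ∈ (T + 1).kerᗮ := by
    refine (Submodule.mem_orthogonal _ _).2 fun s hs => ?_
    have hTs : T s + s = 0 := hs
    rw [inner_add_right, ← adjoint_inner_left, hT, ← inner_add_left, add_comm, hTs,
      inner_zero_left]
  have hneg : z - T z ∈ (T + 1).ker := by
    change T (z - T z) + (z - T z) = 0
    rw [map_sub, hTz, sub_add_sub_cancel, sub_self]
  have hRpos := reflectionAlong_apply_of_mem_orthogonal hpos
  have hRneg := reflectionAlong_apply_of_mem hneg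
  rw [map_add] at hRpos
  rw [map_sub] at hRneg
  linear_combination (norm := module) (1 / 2 : ℂ) • (hRpos + hRneg)

end Reflection

section Colligation

variable {K 𝒰 H : Type*} [NormedAddCommGroup K] [InnerProductSpace ℂ K]
  [NormedAddCommGroup 𝒰] [InnerProductSpace ℂ 𝒰] [NormedAddCommGroup H] [InnerProductSpace ℂ H]

/-- The operator `(u, h) ↦ (-G(u, h), u)`, the closure of whose range is the `-1`-eigenspace of
the colligation attached to `G`. -/
def graphOp (G : WithLp 2 (𝒰 × H) →L[ℂ] K) : WithLp 2 (𝒰 × H) →L[ℂ] WithLp 2 (K × 𝒰) :=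
  inrL K 𝒰 ∘L WithLp.fstL 2 ℂ 𝒰 H - inlL K 𝒰 ∘L G

theorem graphOp_apply (G : WithLp 2 (𝒰 × H) →L[ℂ] K) (x : WithLp 2 (𝒰 × H)) :
    graphOp G x = WithLp.toLp 2 (-G x, x.fst) := by
  have h : graphOp G x = inrL K 𝒰 x.fst - inlL K 𝒰 (G x) := rfl
  rw [h, inlL_apply, inrL_apply, ← WithLp.toLp_sub, Prod.mk_sub_mk, zero_sub, sub_zero]

variable [CompleteSpace K] [CompleteSpace 𝒰]

theorem mem_orthogonal_range_graphOp [CompleteSpace H] {G : WithLp 2 (𝒰 × H) →L[ℂ] K} {v : K}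
    {y : 𝒰} (h : adjoint G v = WithLp.toLp 2 (y, 0)) :
    WithLp.toLp 2 (v, y) ∈ (graphOp G).rangeᗮ := by
  rw [Submodule.mem_orthogonal]
  rintro _ ⟨x, rfl⟩
  have hG : inner ℂ (G x) v = inner ℂ x.fst y := by
    rw [← adjoint_inner_right, h, WithLp.prod_inner_apply]
    simp
  change inner ℂ (graphOp G x) _ = 0
  rw [graphOp_apply, WithLp.prod_inner_apply]
  simp [hG]

/-- The self-adjoint unitary colligation attached to `G`: the reflection whose `-1`-eigenspace is
the closure of the range of `graphOp G`. -/
def colligation (G : WithLp 2 (𝒰 × H) →L[ℂ] K) : WithLp 2 (K × 𝒰) →L[ℂ] WithLp 2 (K × 𝒰) :=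
  reflectionAlong (graphOp G).range

variable {G : WithLp 2 (𝒰 × H) →L[ℂ] K}

theorem isUnit_one_sub_block11_colligation_comp {W : K →L[ℂ] K} (hW : ‖W‖ < 1) :
    IsUnit (1 - block11 (colligation G) ∘L W) := by
  refine isUnit_one_sub_of_norm_lt_one (x := block11 (colligation G) ∘L W) ?_
  calc ‖block11 (colligation G) ∘L W‖ ≤ ‖block11 (colligation G)‖ * ‖W‖ := opNorm_comp_le _ _
    _ ≤ 1 * ‖W‖ := by
        gcongr; exact (norm_block11_le _).trans (norm_reflectionAlong_le_one _)
    _ < 1 := by rwa [one_mul]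

theorem transfer_colligation [CompleteSpace H] {Z W : K →L[ℂ] K} (hZW : (1 - W) * Z = 1 + W)
    (hA : IsUnit (1 - block11 (colligation G) ∘L W))
    (hd : IsUnit (block22 (adjoint G ∘L Z ∘L G)))
    (hs : IsUnit (schur (adjoint G ∘L Z ∘L G) + 1)) :
    transfer (colligation G) W =
      (schur (adjoint G ∘L Z ∘L G) - 1) * Ring.inverse (schur (adjoint G ∘L Z ∘L G) + 1) := by
  ext e
  set f := schur (adjoint G ∘L Z ∘L G)
  set u := Ring.inverse (f + 1) e
  have he : f u + u = e := apply_inverse_apply hs e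
  obtain ⟨h, hh⟩ := exists_apply_eq_schur hd u
  set x := G (WithLp.toLp 2 (u, h))
  have hneg : colligation G (WithLp.toLp 2 (-x, u)) = -WithLp.toLp 2 (-x, u) := by
    have hx := graphOp_apply G (WithLp.toLp 2 (u, h))
    exact reflectionAlong_apply_of_mem ⟨_, hx⟩
  have hpos : colligation G (WithLp.toLp 2 (Z x, f u)) = WithLp.toLp 2 (Z x, f u) :=
    reflectionAlong_apply_of_mem_orthogonal (mem_orthogonal_range_graphOp hh)
  have hW : W (Z x + x) = Z x - x := by
    have hx : Z x - W (Z x) = x + W x := congr($hZW x)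
    rw [map_add]
    linear_combination (norm := module) -hx
  have hsum : WithLp.toLp 2 (W (Z x + x), e) =
      WithLp.toLp 2 (Z x, f u) + WithLp.toLp 2 (-x, u) := by
    rw [hW, ← he, ← WithLp.toLp_add, Prod.mk_add_mk, sub_eq_add_neg]
  change transfer (colligation G) W e = f u - u
  refine transfer_apply_eq (s := Z x + x) hA ?_
  rw [hsum, map_add, hneg, hpos, ← sub_eq_add_neg, ← WithLp.toLp_sub, Prod.mk_sub_mk,
    sub_neg_eq_add]

end Colligation

section SelfAdjointUnitary

variable {K 𝒰 : Type*} [NormedAddCommGroup K] [InnerProductSpace ℂ K]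
  [NormedAddCommGroup 𝒰] [InnerProductSpace ℂ 𝒰]
  (T : WithLp 2 (K × 𝒰) →L[ℂ] WithLp 2 (K × 𝒰))

/-- The space of vectors `x` with `T (x, 0) = -(x, 0)`, the part of the `-1`-eigenspace of `T` that
does not see the external space `𝒰`. -/
def innerSpace : Submodule ℂ K := (T + 1).ker.comap (inlL K 𝒰).toLinearMap

instance completeSpace_innerSpace [CompleteSpace K] : CompleteSpace (innerSpace T) :=
  ((T + 1).isClosed_ker.preimage (inlL K 𝒰).continuous).completeSpace_coe

/-- The operator `(u, h) ↦ B (I - D)⁻¹ u + h`, for which `graphOp` parametrizes the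
`-1`-eigenspace of `T` when `T` is an involution and `I - D` is invertible. -/
def colligationOp : WithLp 2 (𝒰 × innerSpace T) →L[ℂ] K :=
  block12 T ∘L Ring.inverse (1 - block22 T) ∘L WithLp.fstL 2 ℂ 𝒰 (innerSpace T) +
    (innerSpace T).subtypeL ∘L WithLp.sndL 2 ℂ 𝒰 (innerSpace T)

theorem colligationOp_apply (u : 𝒰) (h : innerSpace T) :
    colligationOp T (WithLp.toLp 2 (u, h)) = block12 T (Ring.inverse (1 - block22 T) u) + h := rfl

theorem graphOp_colligationOp_apply (u : 𝒰) (h : innerSpace T) :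
    graphOp (colligationOp T) (WithLp.toLp 2 (u, h)) =
      WithLp.toLp 2 (-block12 T (Ring.inverse (1 - block22 T) u) - h, u) := by
  rw [graphOp_apply, colligationOp_apply, neg_add']
  rfl

theorem norm_colligationOp_inrL (h : innerSpace T) :
    ‖colligationOp T (inrL 𝒰 (innerSpace T) h)‖ = ‖h‖ := by
  rw [inrL_apply, colligationOp_apply, map_zero, map_zero, zero_add, Submodule.norm_coe]

variable {T}

theorem graphOp_colligationOp_mem_ker (hTT : T * T = 1) (hD : IsUnit (1 - block22 T))
    (x : WithLp 2 (𝒰 × innerSpace T)) : graphOp (colligationOp T) x ∈ (T + 1).ker := by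
  obtain ⟨⟨u, h⟩, rfl⟩ := WithLp.toLp_surjective 2 x
  set w := Ring.inverse (1 - block22 T) u with hw
  have hu : w - block22 T w = u := apply_inverse_apply hD u
  have hsplit : graphOp (colligationOp T) (WithLp.toLp 2 (u, h)) =
      (WithLp.toLp 2 (0, w) - T (WithLp.toLp 2 (0, w))) - inlL K 𝒰 h := by
    rw [graphOp_colligationOp_apply, apply_toLp_eq, inlL_apply, ← WithLp.toLp_sub,
      ← WithLp.toLp_sub, ← hw, map_zero, map_zero, zero_add, zero_add, Prod.mk_sub_mk,
      Prod.mk_sub_mk, hu, sub_zero, zero_sub]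
  rw [hsplit]
  refine sub_mem ?_ h.2
  have hTw : T (T (WithLp.toLp 2 (0, w))) = WithLp.toLp 2 (0, w) := congr($hTT _)
  change T (_ - T _) + (_ - T _) = 0
  rw [map_sub, hTw, sub_add_sub_cancel, sub_self]

theorem range_graphOp_colligationOp (hTT : T * T = 1) (hD : IsUnit (1 - block22 T)) :
    (graphOp (colligationOp T)).range = (T + 1).ker := by
  refine le_antisymm (LinearMap.range_le_iff_comap.2 ?_) fun z hz => ?_
  · exact eq_top_iff.2 fun x _ => graphOp_colligationOp_mem_ker hTT hD x
  obtain ⟨⟨y, v⟩, rfl⟩ := WithLp.toLp_surjective 2 z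
  set g := block12 T (Ring.inverse (1 - block22 T) v) with hg
  have hdiff : inlL K 𝒰 (-y - g) =
      graphOp (colligationOp T) (WithLp.toLp 2 (v, 0)) - WithLp.toLp 2 (y, v) := by
    rw [graphOp_colligationOp_apply, ← hg, inlL_apply, ← WithLp.toLp_sub, Prod.mk_sub_mk,
      sub_self, Submodule.coe_zero, sub_zero, neg_sub_comm]
  have hmem : -y - g ∈ innerSpace T := by
    change inlL K 𝒰 (-y - g) ∈ (T + 1).ker
    rw [hdiff]
    exact sub_mem (graphOp_colligationOp_mem_ker hTT hD _) hz
  refine ⟨WithLp.toLp 2 (v, ⟨_, hmem⟩), ?_⟩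
  change graphOp (colligationOp T) _ = _
  have hy : -g - (-y - g) = y := by abel
  rw [graphOp_colligationOp_apply, ← hg, hy]

theorem colligation_colligationOp [CompleteSpace K] [CompleteSpace 𝒰] (hT : adjoint T = T)
    (hTT : T * T = 1) (hD : IsUnit (1 - block22 T)) : colligation (colligationOp T) = T := by
  rw [colligation, range_graphOp_colligationOp hTT hD, reflectionAlong_ker_add_one hT hTT]

theorem exists_colligation_eq {K : Type u} [NormedAddCommGroup K] [InnerProductSpace ℂ K]
    [CompleteSpace K] [CompleteSpace 𝒰] {T : WithLp 2 (K × 𝒰) →L[ℂ] WithLp 2 (K × 𝒰)}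
    (hT : adjoint T = T) (hTT : T * T = 1) (hD : IsUnit (1 - block22 T)) :
    ∃ (H : Type u) (_ : NormedAddCommGroup H) (_ : InnerProductSpace ℂ H) (_ : CompleteSpace H)
      (G : WithLp 2 (𝒰 × H) →L[ℂ] K), (∀ h, ‖G (inrL 𝒰 H h)‖ = ‖h‖) ∧ colligation G = T :=
  ⟨innerSpace T, _, _, inferInstance, colligationOp T, norm_colligationOp_inrL T,
    colligation_colligationOp hT hTT hD⟩

end SelfAdjointUnitary

section Compression

variable {E K 𝒰 H : Type*} [NormedAddCommGroup E] [InnerProductSpace ℂ E] [CompleteSpace E]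
  [NormedAddCommGroup K] [InnerProductSpace ℂ K] [CompleteSpace K]
  [NormedAddCommGroup 𝒰] [InnerProductSpace ℂ 𝒰] [CompleteSpace 𝒰]
  [NormedAddCommGroup H] [InnerProductSpace ℂ H] [CompleteSpace H] {T : K →L[ℂ] K}

theorem re_inner_adjoint_comp_comp_nonneg (hT : IsStrictlyPositive (T + star T)) (G : E →L[ℂ] K)
    (x : E) : 0 ≤ (inner ℂ ((adjoint G ∘L T ∘L G) x) x).re := by
  obtain ⟨δ, hδ, h⟩ := exists_pos_le_re_inner_of_isStrictlyPositive_add_star hT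
  rw [comp_apply, adjoint_inner_left]
  exact (by positivity : 0 ≤ δ * ‖G x‖ ^ 2).trans (h (G x))

theorem isUnit_block22_adjoint_comp_comp (hT : IsStrictlyPositive (T + star T))
    {G : WithLp 2 (𝒰 × H) →L[ℂ] K} (hG : ∀ h, ‖G (inrL 𝒰 H h)‖ = ‖h‖) :
    IsUnit (block22 (adjoint G ∘L T ∘L G)) := by
  obtain ⟨δ, hδ, h⟩ := exists_pos_le_re_inner_of_isStrictlyPositive_add_star hT
  refine isUnit_of_le_re_inner _ hδ fun y => ?_
  rw [inner_block22_apply, comp_apply, adjoint_inner_left, ← hG y]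
  exact h (G (inrL 𝒰 H y))

end Compression

section HilbertSum

variable {ι : Type*} [Fintype ι] {E : ι → Type*} [∀ i, NormedAddCommGroup (E i)]
  [∀ i, InnerProductSpace ℂ (E i)] [∀ i, CompleteSpace (E i)]

theorem adjoint_proj_apply [DecidableEq ι] (i : ι) (x : E i) :
    adjoint (PiLp.proj 2 E i : PiLp 2 E →L[ℂ] E i) x = PiLp.single 2 i x := by
  refine ext_inner_right ℂ fun y => ?_
  rw [adjoint_inner_left, PiLp.inner_apply, Finset.sum_eq_single i]
  · simp
  · intro j _ hj
    simp [hj]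
  · simp

theorem proj_comp_adjoint_proj_self (i : ι) :
    (PiLp.proj 2 E i : PiLp 2 E →L[ℂ] E i) ∘L adjoint (PiLp.proj 2 E i) = 1 := by
  classical
  ext x
  simp [adjoint_proj_apply]

theorem proj_comp_adjoint_proj_of_ne {i j : ι} (hij : i ≠ j) :
    (PiLp.proj 2 E i : PiLp 2 E →L[ℂ] E i) ∘L adjoint (PiLp.proj 2 E j) = 0 := by
  classical
  ext x
  simp [adjoint_proj_apply, hij]

end HilbertSum

section Coordinates

variable {N : ℕ} {n : Fin N → ℕ}

/-- The coordinate projection of `ℂ^{n_1 + ⋯ + n_N}` onto `ℂ^{n_k}`. -/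
def projBlock (n : Fin N → ℕ) (k : Fin N) :
    EuclideanSpace ℂ (Idx n) →L[ℂ] EuclideanSpace ℂ (Fin (n k)) :=
  PiLp.proj 2 (fun k => EuclideanSpace ℂ (Fin (n k))) k ∘L
    (LinearIsometryEquiv.piLpCurry ℂ 2 fun (k : Fin N) (_ : Fin (n k)) => ℂ).toContinuousLinearEquiv

theorem projBlock_apply (k : Fin N) (x : EuclideanSpace ℂ (Idx n)) (i : Fin (n k)) :
    projBlock n k x i = x ⟨k, i⟩ := rfl

theorem projBlock_comp_adjoint (k l : Fin N) :
    projBlock n k ∘L adjoint (projBlock n l) =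
      PiLp.proj 2 (fun k => EuclideanSpace ℂ (Fin (n k))) k ∘L
        adjoint (PiLp.proj 2 (fun k => EuclideanSpace ℂ (Fin (n k))) l) := by
  ext1 x
  rw [projBlock, projBlock, adjoint_comp, LinearIsometryEquiv.adjoint_eq_symm]
  simp only [comp_apply]
  exact congrArg _ (LinearIsometryEquiv.apply_symm_apply _ _)

theorem sum_adjoint_projBlock_comp_projBlock :
    ∑ k, adjoint (projBlock n k) ∘L projBlock n k = 1 := by
  ext1 x
  refine ext_inner_right ℂ fun y => ?_
  simp only [_root_.sum_apply, sum_inner, comp_apply, adjoint_inner_left, one_apply_eq_self,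
    PiLp.inner_apply, projBlock_apply]
  rw [Fintype.sum_sigma]

theorem projBlock_comp_toEuclideanCLM_blockDiagonal' (Z : MatTuple n) (k : Fin N) :
    projBlock n k ∘L Matrix.toEuclideanCLM (n := Idx n) (𝕜 := ℂ) (Matrix.blockDiagonal' Z) =
      Matrix.toEuclideanCLM (n := Fin (n k)) (𝕜 := ℂ) (Z k) ∘L projBlock n k := by
  ext x i
  rw [comp_apply, comp_apply, projBlock_apply, Matrix.ofLp_toEuclideanCLM,
    Matrix.ofLp_toEuclideanCLM, Matrix.mulVec, Matrix.mulVec, dotProduct, dotProduct,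
    Fintype.sum_sigma, Finset.sum_eq_single k]
  · simp [projBlock_apply]
  · intro l _ hl
    refine Finset.sum_eq_zero fun j _ => ?_
    rw [Matrix.blockDiagonal'_apply_ne _ _ _ hl.symm, zero_mul]
  · simp

variable (X : Type u) [NormedAddCommGroup X] [InnerProductSpace ℂ X] [CompleteSpace X]

theorem rTensor_projBlock_comp_blockTensor (Z : MatTuple n) (k : Fin N) :
    (projBlock n k).rTensor X ∘L blockTensor n X Z =
      tensorId (Z k) X ∘L (projBlock n k).rTensor X := by
  rw [← tensorId_blockDiagonal', tensorId, tensorId, ← rTensor_comp, ← rTensor_comp,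
    projBlock_comp_toEuclideanCLM_blockDiagonal']

theorem sum_adjoint_rTensor_projBlock_comp_rTensor_projBlock :
    ∑ k, adjoint ((projBlock n k).rTensor X) ∘L (projBlock n k).rTensor X = 1 := by
  have h := map_sum (rTensorStarAlgHom (EuclideanSpace ℂ (Idx n)) X)
    (fun k => adjoint (projBlock n k) ∘L projBlock n k) Finset.univ
  rw [sum_adjoint_projBlock_comp_projBlock, map_one] at h
  rw [h]
  refine Finset.sum_congr rfl fun k _ => ?_
  rw [adjoint_rTensor, ← rTensor_comp]
  rfl

end Coordinates

section Pencil

variable {N : ℕ} {n : Fin N → ℕ} {X : Type u} [NormedAddCommGroup X] [InnerProductSpace ℂ X]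
  [CompleteSpace X]

variable {𝒰 H : Type u}
  [NormedAddCommGroup 𝒰] [InnerProductSpace ℂ 𝒰] [CompleteSpace 𝒰]
  [NormedAddCommGroup H] [InnerProductSpace ℂ H] [CompleteSpace H]

/-- The pencil `Z ↦ G^* (diag(Z_1, …, Z_N) ⊗ I_X) G` with a single coefficient operator `G`. -/
def blockPencil (G : WithLp 2 (𝒰 × H) →L[ℂ] EuclideanSpace ℂ (Idx n) ⊗[ℂ] X) :
    MatTuple n →ₗ[ℂ] WithLp 2 (𝒰 × H) →L[ℂ] WithLp 2 (𝒰 × H) where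
  toFun Z := adjoint G ∘L blockTensor n X Z ∘L G
  map_add' Z Y := by rw [map_add, add_comp, comp_add]
  map_smul' c Z := by rw [map_smul, smul_comp, comp_smul, RingHom.id_apply]

theorem pencil_rTensor_projBlock_comp
    (G : WithLp 2 (𝒰 × H) →L[ℂ] EuclideanSpace ℂ (Idx n) ⊗[ℂ] X) (Z : MatTuple n) :
    pencil (fun k => (projBlock n k).rTensor X ∘L G) Z = blockPencil G Z := by
  have hterm (k : Fin N) : adjoint ((projBlock n k).rTensor X ∘L G) ∘L tensorId (Z k) X ∘L
      (projBlock n k).rTensor X ∘L G =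
      adjoint G ∘L (adjoint ((projBlock n k).rTensor X) ∘L (projBlock n k).rTensor X) ∘L
        blockTensor n X Z ∘L G := by
    rw [adjoint_comp, ← comp_assoc (tensorId (Z k) X), ← rTensor_projBlock_comp_blockTensor]
    simp only [comp_assoc]
  simp only [pencil, hterm]
  rw [← comp_finsetSum, ← finsetSum_comp, sum_adjoint_rTensor_projBlock_comp_rTensor_projBlock]
  rfl

variable {M : Fin N → Type u} [∀ k, NormedAddCommGroup (M k)] [∀ k, InnerProductSpace ℂ (M k)]
  [∀ k, CompleteSpace (M k)]

theorem pencil_lTensor_comp (Y : Fin N → Type u) [∀ k, NormedAddCommGroup (Y k)]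
    [∀ k, InnerProductSpace ℂ (Y k)] [∀ k, CompleteSpace (Y k)] {V : ∀ k, M k →L[ℂ] Y k}
    (hV : ∀ k, adjoint (V k) ∘L V k = 1)
    (G : ∀ k, WithLp 2 (𝒰 × H) →L[ℂ] (EuclideanSpace ℂ (Fin (n k)) ⊗[ℂ] M k)) (Z : MatTuple n) :
    pencil (fun k => (V k).lTensor (EuclideanSpace ℂ (Fin (n k))) ∘L G k) Z = pencil G Z := by
  refine Finset.sum_congr rfl fun k _ => ?_
  have hk : adjoint ((V k).lTensor (EuclideanSpace ℂ (Fin (n k)))) ∘L tensorId (Z k) (Y k) ∘L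
      (V k).lTensor (EuclideanSpace ℂ (Fin (n k))) = tensorId (Z k) (M k) := by
    rw [tensorId, rTensor_comp_lTensor, ← lTensor_comp_rTensor, ← comp_assoc, adjoint_lTensor,
      ← lTensor_comp, hV, lTensor_one]
    rfl
  rw [adjoint_comp, ← hk]
  simp only [comp_assoc]

/-- The operator `∑_k P_k^* G_k` into `ℂ^{n_1 + ⋯ + n_N} ⊗ X` whose components are the `G_k`. -/
def assemble {E : Type*} [NormedAddCommGroup E] [InnerProductSpace ℂ E]
    (G : ∀ k, E →L[ℂ] EuclideanSpace ℂ (Fin (n k)) ⊗[ℂ] X) :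
    E →L[ℂ] EuclideanSpace ℂ (Idx n) ⊗[ℂ] X :=
  ∑ k, adjoint ((projBlock n k).rTensor X) ∘L G k

theorem rTensor_projBlock_comp_assemble {E : Type*} [NormedAddCommGroup E] [InnerProductSpace ℂ E]
    (G : ∀ k, E →L[ℂ] EuclideanSpace ℂ (Fin (n k)) ⊗[ℂ] X) (k : Fin N) :
    (projBlock n k).rTensor X ∘L assemble G = G k := by
  rw [assemble, comp_finsetSum, Finset.sum_eq_single k]
  · rw [← comp_assoc, adjoint_rTensor, ← rTensor_comp, projBlock_comp_adjoint,
      proj_comp_adjoint_proj_self, rTensor_one]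
    rfl
  · intro l _ hl
    rw [← comp_assoc, adjoint_rTensor, ← rTensor_comp, projBlock_comp_adjoint,
      proj_comp_adjoint_proj_of_ne hl.symm, rTensor_zero, zero_comp]
  · simp

theorem exists_blockPencil_eq_pencil
    (G : ∀ k, WithLp 2 (𝒰 × H) →L[ℂ] (EuclideanSpace ℂ (Fin (n k)) ⊗[ℂ] M k)) :
    ∃ G' : WithLp 2 (𝒰 × H) →L[ℂ] EuclideanSpace ℂ (Idx n) ⊗[ℂ] PiLp 2 M,
      ∀ Z, blockPencil G' Z = pencil G Z := by
  let embed (k : Fin N) : M k →L[ℂ] PiLp 2 M := adjoint (PiLp.proj 2 M k)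
  have hembed (k : Fin N) : adjoint (embed k) ∘L embed k = 1 := by
    rw [adjoint_adjoint, proj_comp_adjoint_proj_self]
  refine ⟨assemble fun k => (embed k).lTensor _ ∘L G k, fun Z => ?_⟩
  rw [← pencil_rTensor_projBlock_comp]
  simp only [rTensor_projBlock_comp_assemble]
  exact pencil_lTensor_comp (fun _ => PiLp 2 M) hembed G Z

theorem isUnit_block22_blockPencil {G : WithLp 2 (𝒰 × H) →L[ℂ] EuclideanSpace ℂ (Idx n) ⊗[ℂ] X}
    (hG : ∀ h, ‖G (inrL 𝒰 H h)‖ = ‖h‖) {Z : MatTuple n} (hZ : Z ∈ omega n) :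
    IsUnit (block22 (blockPencil G Z)) := by
  obtain ⟨l, hl, Y, hY, rfl⟩ := hZ
  have hl0 : l ≠ 0 := norm_ne_zero_iff.1 (hl ▸ one_ne_zero)
  have hsmul : block22 (blockPencil G (l • Y)) = l • block22 (blockPencil G Y) := by
    rw [map_smul, block22, block22, smul_comp, comp_smul]
  have hunit : IsUnit (block22 (blockPencil G Y)) :=
    isUnit_block22_adjoint_comp_comp (isStrictlyPositive_blockTensor_add_star hY) hG
  rw [hsmul]
  exact hunit.smul (Units.mk0 l hl0)

section Holomorphy

attribute [local instance] Matrix.normedAddCommGroup Matrix.normedSpace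

theorem differentiableOn_schur_blockPencil
    {G : WithLp 2 (𝒰 × H) →L[ℂ] EuclideanSpace ℂ (Idx n) ⊗[ℂ] X} {s : Set (MatTuple n)}
    (hG : ∀ Z ∈ s, IsUnit (block22 (blockPencil G Z))) :
    DifferentiableOn ℂ (fun Z => schur (blockPencil G Z)) s := fun Z hZ =>
  (differentiableAt_schur_comp (LinearMap.toContinuousLinearMap (blockPencil G)).differentiableAt
    (hG Z hZ)).differentiableWithinAt

end Holomorphy

theorem mem_bessmertnyiClass_iff {f : MatTuple n → 𝒰 →L[ℂ] 𝒰} :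
    f ∈ bessmertnyiClass n 𝒰 ↔
      ∃ (X : Type u) (_ : NormedAddCommGroup X) (_ : InnerProductSpace ℂ X) (_ : CompleteSpace X)
        (H : Type u) (_ : NormedAddCommGroup H) (_ : InnerProductSpace ℂ H) (_ : CompleteSpace H)
        (G : WithLp 2 (𝒰 × H) →L[ℂ] EuclideanSpace ℂ (Idx n) ⊗[ℂ] X),
        ∀ Z ∈ omega n, IsUnit (block22 (blockPencil G Z)) ∧ f Z = schur (blockPencil G Z) := by
  constructor
  · rintro ⟨-, M, _, _, _, H, _, _, _, G, hG⟩
    obtain ⟨G', hG'⟩ := exists_blockPencil_eq_pencil G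
    refine ⟨PiLp 2 M, _, _, inferInstance, H, _, _, inferInstance, G', fun Z hZ => ?_⟩
    rw [hG' Z]
    exact hG Z hZ
  · rintro ⟨X, _, _, _, H, _, _, _, G, hG⟩
    refine ⟨(differentiableOn_schur_blockPencil fun Z hZ => (hG Z hZ).1).congr
      fun Z hZ => (hG Z hZ).2, fun _ => X, _, _, inferInstance, H, _, _,
      inferInstance, fun k => (projBlock n k).rTensor X ∘L G, fun Z hZ => ?_⟩
    rw [pencil_rTensor_projBlock_comp]
    exact hG Z hZ

end Pencil

section Main

variable {N : ℕ} {n : Fin N → ℕ} {𝒰 : Type u}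
  [NormedAddCommGroup 𝒰] [InnerProductSpace ℂ 𝒰]
  {f F : MatTuple n → 𝒰 →L[ℂ] 𝒰}

theorem one_notMem_spectrum_doubleCayley {W : MatTuple n} (hf : IsUnit (f (cayley W) + 1)) :
    (1 : ℂ) ∉ spectrum ℂ (doubleCayley f W) := by
  rw [spectrum.notMem_iff, map_one, doubleCayley]
  set g := f (cayley W)
  have key : 1 - (g - 1) * Ring.inverse (g + 1) = (2 : ℂ) • Ring.inverse (g + 1) := by
    calc 1 - (g - 1) * Ring.inverse (g + 1)
        = (g + 1) * Ring.inverse (g + 1) - (g - 1) * Ring.inverse (g + 1) := by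
          rw [Ring.mul_inverse_cancel _ hf]
      _ = (2 : ℂ) • Ring.inverse (g + 1) := by
          rw [two_smul]
          noncomm_ring
  rw [key]
  exact hf.ringInverse.smul (Units.mk0 (2 : ℂ) two_ne_zero)

theorem isUnit_one_sub_block22_of_isRealizedBy {X : Type u} [NormedAddCommGroup X]
    [InnerProductSpace ℂ X] [CompleteSpace X]
    {T : WithLp 2 ((EuclideanSpace ℂ (Idx n) ⊗[ℂ] X) × 𝒰) →L[ℂ]
      WithLp 2 ((EuclideanSpace ℂ (Idx n) ⊗[ℂ] X) × 𝒰)}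
    (hFT : IsRealizedBy F T) (hF0 : (1 : ℂ) ∉ spectrum ℂ (F 0)) : IsUnit (1 - block22 T) := by
  have h0 : F 0 = transfer T (blockTensor n X 0) := (hFT 0 zero_mem_disk).2
  rw [map_zero, transfer_zero] at h0
  rwa [spectrum.notMem_iff, map_one, h0] at hF0

variable [CompleteSpace 𝒰]

theorem isUnit_schur_blockPencil_add_one {H X : Type u} [NormedAddCommGroup H]
    [InnerProductSpace ℂ H] [CompleteSpace H] [NormedAddCommGroup X] [InnerProductSpace ℂ X]
    [CompleteSpace X] {G : WithLp 2 (𝒰 × H) →L[ℂ] EuclideanSpace ℂ (Idx n) ⊗[ℂ] X}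
    {Z : MatTuple n} (hZ : Z ∈ halfplane n) (hd : IsUnit (block22 (blockPencil G Z))) :
    IsUnit (schur (blockPencil G Z) + 1) :=
  isUnit_schur_add_one hd <|
    re_inner_adjoint_comp_comp_nonneg (isStrictlyPositive_blockTensor_add_star hZ) G

theorem isUnit_add_one_of_mem_bessmertnyiClass (hf : f ∈ bessmertnyiClass n 𝒰) {Z : MatTuple n}
    (hZ : Z ∈ halfplane n) : IsUnit (f Z + 1) := by
  obtain ⟨X, _, _, _, H, _, _, _, G, hG⟩ := mem_bessmertnyiClass_iff.1 hf
  obtain ⟨hd, hfZ⟩ := hG Z (halfplane_subset_omega hZ)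
  rw [hfZ]
  exact isUnit_schur_blockPencil_add_one hZ hd

theorem doubleCayley_eq_transfer_colligation {H X : Type u} [NormedAddCommGroup H]
    [InnerProductSpace ℂ H] [CompleteSpace H] [NormedAddCommGroup X] [InnerProductSpace ℂ X]
    [CompleteSpace X] {G : WithLp 2 (𝒰 × H) →L[ℂ] EuclideanSpace ℂ (Idx n) ⊗[ℂ] X}
    {W : MatTuple n} (hW : W ∈ disk n) (hd : IsUnit (block22 (blockPencil G (cayley W))))
    (hf : f (cayley W) = schur (blockPencil G (cayley W))) :
    doubleCayley f W = transfer (colligation G) (blockTensor n X W) := by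
  rw [doubleCayley, hf]
  exact (transfer_colligation (one_sub_mul_blockTensor_cayley hW)
    (isUnit_one_sub_block11_colligation_comp (norm_blockTensor_lt_one hW)) hd
    (isUnit_schur_blockPencil_add_one (cayley_mem_halfplane hW) hd)).symm

theorem exists_isRealizedBy_of_mem_bessmertnyiClass (hf : f ∈ bessmertnyiClass n 𝒰)
    (hF : ∀ W ∈ disk n, F W = doubleCayley f W) :
    ∃ (X : Type u) (_ : NormedAddCommGroup X) (_ : InnerProductSpace ℂ X) (_ : CompleteSpace X)
      (T : WithLp 2 ((EuclideanSpace ℂ (Idx n) ⊗[ℂ] X) × 𝒰) →L[ℂ]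
        WithLp 2 ((EuclideanSpace ℂ (Idx n) ⊗[ℂ] X) × 𝒰)),
      adjoint T = T ∧ T * T = 1 ∧ IsRealizedBy F T := by
  obtain ⟨X, _, _, _, H, _, _, _, G, hG⟩ := mem_bessmertnyiClass_iff.1 hf
  refine ⟨X, _, _, inferInstance, colligation G, adjoint_reflectionAlong _,
    reflectionAlong_mul_self _, fun W hW => ?_⟩
  obtain ⟨hd, hfW⟩ := hG (cayley W) (halfplane_subset_omega (cayley_mem_halfplane hW))
  refine ⟨isUnit_one_sub_block11_colligation_comp (norm_blockTensor_lt_one hW), ?_⟩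
  exact (hF W hW).trans (doubleCayley_eq_transfer_colligation hW hd hfW)

theorem schur_blockPencil_mem_bessmertnyiClass {H X : Type u} [NormedAddCommGroup H]
    [InnerProductSpace ℂ H] [CompleteSpace H] [NormedAddCommGroup X] [InnerProductSpace ℂ X]
    [CompleteSpace X] {G : WithLp 2 (𝒰 × H) →L[ℂ] EuclideanSpace ℂ (Idx n) ⊗[ℂ] X}
    (hG : ∀ h, ‖G (inrL 𝒰 H h)‖ = ‖h‖) :
    (fun Z => schur (blockPencil G Z)) ∈ bessmertnyiClass n 𝒰 :=
  mem_bessmertnyiClass_iff.2 ⟨X, _, _, inferInstance, H, _, _, inferInstance, G, fun _ hZ =>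
    ⟨isUnit_block22_blockPencil hG hZ, rfl⟩⟩

theorem exists_mem_bessmertnyiClass_of_isRealizedBy {X : Type u} [NormedAddCommGroup X]
    [InnerProductSpace ℂ X] [CompleteSpace X]
    {T : WithLp 2 ((EuclideanSpace ℂ (Idx n) ⊗[ℂ] X) × 𝒰) →L[ℂ]
      WithLp 2 ((EuclideanSpace ℂ (Idx n) ⊗[ℂ] X) × 𝒰)}
    (hT : adjoint T = T) (hTT : T * T = 1) (hD : IsUnit (1 - block22 T))
    (hFT : IsRealizedBy F T) :
    ∃ f ∈ bessmertnyiClass n 𝒰, ∀ W ∈ disk n, F W = doubleCayley f W := by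
  obtain ⟨H, _, _, _, G, hG, hGT⟩ := exists_colligation_eq hT hTT hD
  refine ⟨_, schur_blockPencil_mem_bessmertnyiClass hG, fun W hW => ?_⟩
  have hd := isUnit_block22_blockPencil hG (halfplane_subset_omega (cayley_mem_halfplane hW))
  rw [doubleCayley_eq_transfer_colligation hW hd rfl, hGT]
  exact (hFT W hW).2

end Main

end Bessmertnyi

end

theorem mainTheorem2_general {N : ℕ} (n : Fin N → ℕ) (𝒰 : Type u)
    [NormedAddCommGroup 𝒰] [InnerProductSpace ℂ 𝒰] [CompleteSpace 𝒰]
    (F : Bessmertnyi.MatTuple n → 𝒰 →L[ℂ] 𝒰) :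
    (∀ f ∈ Bessmertnyi.bessmertnyiClass n 𝒰, ∀ W ∈ Bessmertnyi.disk n,
      IsUnit (f (Bessmertnyi.cayley W) + 1)) ∧
    ((∃ f ∈ Bessmertnyi.bessmertnyiClass n 𝒰,
        ∀ W ∈ Bessmertnyi.disk n, F W = Bessmertnyi.doubleCayley f W) ↔
      (∃ (X : Type u) (_ : NormedAddCommGroup X) (_ : InnerProductSpace ℂ X)
          (_ : CompleteSpace X)
          (T : WithLp 2 ((EuclideanSpace ℂ (Bessmertnyi.Idx n) ⊗[ℂ] X) × 𝒰) →L[ℂ]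
            WithLp 2 ((EuclideanSpace ℂ (Bessmertnyi.Idx n) ⊗[ℂ] X) × 𝒰)),
          ContinuousLinearMap.adjoint T = T ∧ T * T = 1 ∧ Bessmertnyi.IsRealizedBy F T) ∧
      (1 : ℂ) ∉ spectrum ℂ (F 0)) := by
  have hunit : ∀ f ∈ Bessmertnyi.bessmertnyiClass n 𝒰, ∀ W ∈ Bessmertnyi.disk n,
      IsUnit (f (Bessmertnyi.cayley W) + 1) := fun f hf W hW =>
    Bessmertnyi.isUnit_add_one_of_mem_bessmertnyiClass hf (Bessmertnyi.cayley_mem_halfplane hW)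
  refine ⟨hunit, ?_, ?_⟩
  · rintro ⟨f, hf, hFf⟩
    refine ⟨Bessmertnyi.exists_isRealizedBy_of_mem_bessmertnyiClass hf hFf, ?_⟩
    rw [hFf 0 Bessmertnyi.zero_mem_disk]
    exact Bessmertnyi.one_notMem_spectrum_doubleCayley (hunit f hf 0 Bessmertnyi.zero_mem_disk)
  · rintro ⟨⟨X, _, _, _, T, hT, hTT, hFT⟩, hF0⟩
    exact Bessmertnyi.exists_mem_bessmertnyiClass_of_isRealizedBy hT hTT
      (Bessmertnyi.isUnit_one_sub_block22_of_isRealizedBy hFT hF0) hFT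

/-- The double Cayley transform is well defined on the Bessmertnyĭ class (first conjunct), and its
image is characterized by a realization with a self-adjoint unitary colligation together with
`1 ∉ σ(F(0))` (second conjunct). -/
theorem mainTheorem2 {N : ℕ} (n : Fin N → ℕ) (𝒰 : Type u)
    [NormedAddCommGroup 𝒰] [InnerProductSpace ℂ 𝒰] [CompleteSpace 𝒰]
    (F : Bessmertnyi.MatTuple n → 𝒰 →L[ℂ] 𝒰)
    (hF : DifferentiableOn ℂ F (Bessmertnyi.disk n)) :
    (∀ f ∈ Bessmertnyi.bessmertnyiClass n 𝒰, ∀ W ∈ Bessmertnyi.disk n,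
      IsUnit (f (Bessmertnyi.cayley W) + 1)) ∧
    ((∃ f ∈ Bessmertnyi.bessmertnyiClass n 𝒰,
        ∀ W ∈ Bessmertnyi.disk n, F W = Bessmertnyi.doubleCayley f W) ↔
      (∃ (X : Type u) (_ : NormedAddCommGroup X) (_ : InnerProductSpace ℂ X)
          (_ : CompleteSpace X)
          (T : WithLp 2 ((EuclideanSpace ℂ (Bessmertnyi.Idx n) ⊗[ℂ] X) × 𝒰) →L[ℂ]
            WithLp 2 ((EuclideanSpace ℂ (Bessmertnyi.Idx n) ⊗[ℂ] X) × 𝒰)),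
          ContinuousLinearMap.adjoint T = T ∧ T * T = 1 ∧ Bessmertnyi.IsRealizedBy F T) ∧
      (1 : ℂ) ∉ spectrum ℂ (F 0)) :=
  mainTheorem2_general n 𝒰 F
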